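/- Let $G$ be a finite group which is abelian or has odd order. For an integer $a$ (of any sign) with $\gcd(a,|G|)=1$, let $\left(\frac{a}{G}\right)_{el}\in\{1,-1\}$ be the signature of the permutation $\rho_a\colon G\to G$, $g\mapsto g^a$, of the elements of $G$. Put $f_2(G)=\{g\in G: g^2=1\}$, let $n_2(G)$ be the number of Sylow $2$-subgroups of $G$, let $\epsilon(G)=1$ if $|G|=2\,n_2(G)$ and $\epsilon(G)=0$ otherwise, and define the integer $$d_G=(-1)^{\frac{|G|-|f_2(G)|}{2}}\,\frac{|G|^{|f_2(G)|}}{n_2(G)^{\epsilon(G)}}.$$ Then, for every integer $a$ with $\gcd(a,|G|)=1$, $$\left(\frac{a}{G}\right)_{el}=\left(\frac{d_G}{a}\right),$$ where $\left(\frac{n}{a}\right)$ is the Kronecker symbol: the extension of the Legendre symbol to all integers $n,a$ that is multiplicative in $a$, with $\left(\frac{n}{1}\right)=1$; $\left(\frac{n}{-1}\right)=-1$ if $n<0$ and $1$ if $n\ge 0$; $\left(\frac{n}{2}\right)=0$ if $n$ is even, $1$ if $n\equiv 1,7\pmod 8$ and $-1$ if $n\equiv 3,5\pmod 8$; and $\left(\frac{n}{0}\right)=1$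 if $n=1$ and $0$ otherwise. -/

import Mathlib

/-- The power permutation `ρ_a : G → G`, `g ↦ g ^ a`, of a finite group `G`, for an integer `a`
(of any sign) coprime to the order of `G`. -/
noncomputable def powPerm {G : Type*} [Group G] [Finite G] (a : ℤ)
    (ha : IsCoprime a (Nat.card G : ℤ)) : Equiv.Perm G where
  toFun g := g ^ a
  invFun g := g ^ (Int.gcdA a (Nat.card G))
  left_inv g := by
    have hb : (1 : ℤ) = a * Int.gcdA a (Nat.card G) + Nat.card G * Int.gcdB a (Nat.card G) := by
      rw [← Int.gcd_eq_gcd_ab, Int.isCoprime_iff_gcd_eq_one.mp ha, Nat.cast_one]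
    calc (g ^ a) ^ Int.gcdA a (Nat.card G)
        = g ^ (a * Int.gcdA a (Nat.card G) + Nat.card G * Int.gcdB a (Nat.card G)) := by
          rw [zpow_add, zpow_mul, zpow_mul, zpow_natCast, pow_card_eq_one', one_zpow, mul_one]
      _ = g := by rw [← hb, zpow_one]
  right_inv g := by
    have hb : (1 : ℤ) = a * Int.gcdA a (Nat.card G) + Nat.card G * Int.gcdB a (Nat.card G) := by
      rw [← Int.gcd_eq_gcd_ab, Int.isCoprime_iff_gcd_eq_one.mp ha, Nat.cast_one]
    calc (g ^ Int.gcdA a (Nat.card G)) ^ a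
        = g ^ (a * Int.gcdA a (Nat.card G) + Nat.card G * Int.gcdB a (Nat.card G)) := by
          rw [zpow_add, mul_comm a, zpow_mul, zpow_mul, zpow_natCast, pow_card_eq_one', one_zpow,
            mul_one]
      _ = g := by rw [← hb, zpow_one]

/-- The symbol `(a / G)_el`: the signature of the permutation `g ↦ g ^ a` of the elements of `G`. -/
noncomputable def elemSymbol (G : Type*) [Group G] [Fintype G] [DecidableEq G] (a : ℤ)
    (ha : IsCoprime a (Nat.card G : ℤ)) : ℤ :=
  ((Equiv.Perm.sign (powPerm (G := G) a ha) : ℤˣ) : ℤ)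

/-- The Kronecker symbol `(n / a)` of two integers: for `a ≠ 0` write `a = ± 2 ^ v * m` with `m` odd
and positive; then `(n / a) = (n / ±1) * (n / 2) ^ v * (n / m)`, where `(n / 1) = 1`,
`(n / -1)` is `-1` if `n < 0` and `1` otherwise, `(n / 2) = χ₈ n` is `0` for even `n`, `1` for
`n ≡ 1, 7` and `-1` for `n ≡ 3, 5` modulo `8`, and `(n / m)` is the Jacobi symbol.
Moreover `(n / 0)` is `1` if `n = 1` and `0` otherwise. -/
def kroneckerSym (n a : ℤ) : ℤ :=
  if a = 0 then (if n = 1 then 1 else 0)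
  else (if a < 0 ∧ n < 0 then -1 else 1) *
    (ZMod.χ₈ (n : ZMod 8)) ^ padicValNat 2 a.natAbs *
    jacobiSym n (a.natAbs / 2 ^ padicValNat 2 a.natAbs)

/-- `f_m(G)`, the set of solutions of `g ^ m = 1` in `G`. -/
def powKernel (G : Type*) [Group G] (m : ℕ) : Set G := {g : G | g ^ m = 1}

/-- `n_2(G)`, the number of Sylow 2-subgroups of `G`. -/
noncomputable def numSylowTwo (G : Type*) [Group G] : ℕ := Nat.card (Sylow 2 G)

/-- `ε(G)` is `1` if `|G| = 2 n_2(G)`, and `0` otherwise. -/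
noncomputable def epsTwo (G : Type*) [Group G] : ℕ :=
  if Nat.card G = 2 * numSylowTwo G then 1 else 0

/-- `d_G = (-1) ^ ((|G| - |f_2(G)|) / 2) * |G| ^ |f_2(G)| / n_2(G) ^ ε(G)`. For a finite group the
subtraction and both divisions are exact, see the two facts below. -/
noncomputable def powDisc (G : Type*) [Group G] : ℤ :=
  (-1) ^ ((Nat.card G - (powKernel G 2).ncard) / 2) *
    (((Nat.card G ^ (powKernel G 2).ncard) / (numSylowTwo G ^ epsTwo G) : ℕ) : ℤ)

theorem exists_card_eq_powKernel_two (G : Type*) [Group G] [Finite G] :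
    ∃ k : ℕ, Nat.card G = (powKernel G 2).ncard + 2 * k := by
  classical
  have := Fintype.ofFinite G
  have hf : (Equiv.inv G) ^ 2 ^ 1 = 1 := by
    ext g
    simp [pow_two]
  have h1 := Equiv.Perm.card_compl_support_modEq (p := 2) hf
  have h2 : powKernel G 2 = ((Equiv.inv G).supportᶜ : Finset G) := by
    ext g
    simp [powKernel, pow_two, inv_eq_iff_mul_eq_one]
  have h3 : (powKernel G 2).ncard ≤ Nat.card G := Set.ncard_le_card _
  rw [← Set.ncard_coe_finset, ← h2, ← Nat.card_eq_fintype_card] at h1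
  obtain ⟨k, hk⟩ := (Nat.modEq_iff_dvd' h3).mp h1
  exact ⟨k, by omega⟩

theorem numSylowTwo_dvd (G : Type*) [Group G] [Finite G] :
    numSylowTwo G ^ epsTwo G ∣ Nat.card G ^ (powKernel G 2).ncard := by
  have h1 : (powKernel G 2).ncard ≠ 0 := by
    have h : (1 : G) ∈ powKernel G 2 := by simp [powKernel]
    exact Set.ncard_ne_zero_of_mem h
  have h2 : numSylowTwo G ^ epsTwo G ∣ Nat.card G := by
    unfold epsTwo
    split_ifs with h
    · rw [pow_one]; exact ⟨2, by rw [h, mul_comm]⟩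
    · simp
  exact h2.trans (dvd_pow_self _ h1)

/-! The argument goes back to Duke and Hopkins. Let `p` be an odd prime not dividing `|G|`, and let
`X` be the character table of `G` over an algebraically closed field of characteristic `p`. By the
orthogonality relations, `det X ^ 2` is the sign of `C ↦ C⁻¹` on conjugacy classes times the product
of the orders of the centralizers. Raising the entries of `X` to the power `p` permutes its columns
by `C ↦ C ^ p`, so `det X ^ (p - 1)` is the sign of that permutation, and Euler's criterion
evaluates it as a Legendre symbol.

If the center has odd index, all conjugacy classes have odd size. Hence a permutation of `G` that
commutes with conjugation has the same sign as the permutation it induces on the classes. Moreover,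
a class equal to its inverse is a single central element of order at most two, and the centralizers
of the other classes cancel in pairs up to squares. This proves `(p / G)_el = (d_G / p)`. Since
`d_G` is `0` or `1` modulo `4`, the Kronecker symbol `(d_G / a)` only depends on `a` modulo `d_G`,
and by Dirichlet's theorem `a` may be replaced by a prime. -/

section KroneckerSymbol

open NumberTheorySymbols

theorem kroneckerSym_of_odd (d : ℤ) {a : ℤ} (ha : Odd a) :
    kroneckerSym d a = (if a < 0 ∧ d < 0 then -1 else 1) * J(d | a.natAbs) := by
  have ha0 : a ≠ 0 := by rintro rfl; simp at ha
  have hv : padicValNat 2 a.natAbs = 0 :=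
    padicValNat.eq_zero_of_not_dvd (Int.natAbs_odd.mpr ha).not_two_dvd_nat
  rw [kroneckerSym, if_neg ha0, hv, pow_zero, pow_zero, Nat.div_one, mul_one]

theorem kroneckerSym_natCast_of_odd (d : ℤ) {m : ℕ} (hm : Odd m) :
    kroneckerSym d m = J(d | m) := by
  rw [kroneckerSym_of_odd d (by exact_mod_cast hm), if_neg (by omega), one_mul, Int.natAbs_natCast]

theorem kroneckerSym_of_even {d a : ℤ} (hd : Even d) (ha : Even a) : kroneckerSym d a = 0 := by
  have hd1 : d ≠ 1 := by rintro rfl; simp at hd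
  rcases eq_or_ne a 0 with rfl | ha0
  · rw [kroneckerSym, if_pos rfl, if_neg hd1]
  have hχ : ZMod.χ₈ (d : ZMod 8) = 0 := by
    rw [ZMod.χ₈_int_eq_if_mod_eight, if_pos (Int.even_iff.mp hd)]
  have hv : padicValNat 2 a.natAbs ≠ 0 :=
    Nat.one_le_iff_ne_zero.mp (one_le_padicValNat_of_dvd (Int.natAbs_ne_zero.mpr ha0)
      (Int.natAbs_even.mpr ha).two_dvd)
  rw [kroneckerSym, if_neg ha0, hχ, zero_pow hv, mul_zero, zero_mul]

theorem jacobiSym_congr_right {d : ℤ} (hd : d % 4 = 0) {m n : ℕ} (hm : Odd m) (hn : Odd n)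
    (h : m ≡ n [MOD d.natAbs]) : J(d | m) = J(d | n) := by
  have hd4 : d.natAbs = 4 * (d / 4).natAbs := by omega
  rw [← jacobiSym.div_four_left hd (Nat.odd_iff.mp hm),
    ← jacobiSym.div_four_left hd (Nat.odd_iff.mp hn), jacobiSym.mod_right _ hm,
    jacobiSym.mod_right _ hn, ← hd4, h]

theorem jacobiSym_natAbs_sub_one {d : ℤ} (hd : d % 4 = 0) (hd0 : d ≠ 0) :
    J(d | d.natAbs - 1) = d.sign := by
  have hodd : Odd (d.natAbs - 1) := Nat.odd_iff.mpr (by omega)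
  have habs : J((d.natAbs : ℤ) | d.natAbs - 1) = 1 := by
    rw [← jacobiSym.one_left (d.natAbs - 1)]
    refine jacobiSym.mod_left' (Int.ModEq.symm (Int.modEq_iff_dvd.mpr ?_))
    rw [Nat.cast_sub (by omega), Nat.cast_one]
  rcases hd0.lt_or_gt with hneg | hpos
  · have hdabs : d = -(d.natAbs : ℤ) := by omega
    rw [Int.sign_eq_neg_one_of_neg hneg, hdabs, Int.natAbs_neg, Int.natAbs_natCast,
      jacobiSym.neg _ hodd, habs, mul_one, ZMod.χ₄_nat_three_mod_four (by omega)]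
  · rw [Int.sign_eq_one_of_pos hpos, ← habs, Int.natAbs_of_nonneg hpos.le]

theorem kroneckerSym_eq_jacobiSym_of_modEq {d : ℤ} (hd : d % 4 = 0) (hd0 : d ≠ 0) {a : ℤ}
    (ha : Odd a) {m : ℕ} (h : (m : ℤ) ≡ a [ZMOD d]) : kroneckerSym d a = J(d | m) := by
  have hm : Odd m := by
    have h2 := h.of_dvd (show (2 : ℤ) ∣ d by omega)
    rw [Int.ModEq, Int.odd_iff.mp ha] at h2
    exact Nat.odd_iff.mpr (by omega)
  have habs : Odd a.natAbs := Int.natAbs_odd.mpr ha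
  rcases lt_or_ge a 0 with hneg | hpos
  · have hodd : Odd (d.natAbs - 1) := Nat.odd_iff.mpr (by omega)
    have hmod : a.natAbs * (d.natAbs - 1) ≡ m [MOD d.natAbs] := by
      rw [← Int.natCast_modEq_iff, Int.natCast_natAbs d, Int.modEq_abs]
      refine Int.ModEq.trans ?_ h.symm
      have hprod : ((a.natAbs * (d.natAbs - 1) : ℕ) : ℤ) = a - a * |d| := by
        rw [Nat.cast_mul, Nat.cast_sub (by omega), Int.natCast_natAbs, Int.natCast_natAbs,
          abs_of_neg hneg, Nat.cast_one]
        ring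
      rw [hprod, Int.modEq_iff_dvd, sub_sub_cancel]
      exact (self_dvd_abs d).mul_left a
    have : NeZero a.natAbs := ⟨habs.pos.ne'⟩
    have : NeZero (d.natAbs - 1) := ⟨hodd.pos.ne'⟩
    rw [← jacobiSym_congr_right hd (habs.mul hodd) hm hmod, jacobiSym.mul_right,
      jacobiSym_natAbs_sub_one hd hd0, kroneckerSym_of_odd d ha, mul_comm]
    congr 1
    rcases hd0.lt_or_gt with hd' | hd'
    · rw [if_pos ⟨hneg, hd'⟩, Int.sign_eq_neg_one_of_neg hd']
    · rw [if_neg (by omega), Int.sign_eq_one_of_pos hd']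
  · lift a to ℕ using hpos
    rw [kroneckerSym_natCast_of_odd d (by exact_mod_cast ha)]
    refine jacobiSym_congr_right hd habs hm ?_
    rw [← Int.natCast_modEq_iff, Int.natCast_natAbs d, Int.modEq_abs]
    exact h.symm

theorem jacobiSym_eq_jacobiSym_natAbs {d : ℤ} (hd : d % 4 = 1) {m : ℕ} (hm : Odd m) :
    J(d | m) = J(m | d.natAbs) := by
  rcases lt_or_gt_of_ne (show d ≠ 0 by omega) with hneg | hpos
  · have hd3 : d.natAbs % 4 = 3 := by omega
    have hdodd : Odd d.natAbs := Nat.odd_iff.mpr (by omega)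
    have hdabs : d = -(d.natAbs : ℤ) := by omega
    conv_lhs => rw [hdabs, jacobiSym.neg _ hm]
    rcases Nat.odd_mod_four_iff.mp (Nat.odd_iff.mp hm) with hm1 | hm3
    · rw [ZMod.χ₄_nat_one_mod_four hm1, one_mul,
        jacobiSym.quadratic_reciprocity_one_mod_four' hdodd hm1]
    · rw [ZMod.χ₄_nat_three_mod_four hm3, jacobiSym.quadratic_reciprocity_three_mod_four hd3 hm3,
        neg_one_mul, neg_neg]
  · lift d to ℕ using hpos.le
    exact jacobiSym.quadratic_reciprocity_one_mod_four (by omega) hm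

theorem χ₈_eq_jacobiSym_two {d : ℤ} (hd : Odd d) :
    ZMod.χ₈ (d : ZMod 8) = J(2 | d.natAbs) := by
  rw [jacobiSym.at_two (Int.natAbs_odd.mpr hd), ZMod.χ₈_int_eq_if_mod_eight,
    ZMod.χ₈_nat_eq_if_mod_eight]
  have := Int.odd_iff.mp hd
  split_ifs <;> first | rfl | omega

theorem jacobiSym_neg_one_natAbs {d : ℤ} (hd : d % 4 = 1) :
    J(-1 | d.natAbs) = if d < 0 then -1 else 1 := by
  rw [jacobiSym.at_neg_one (Nat.odd_iff.mpr (by omega))]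
  split_ifs with h
  · exact ZMod.χ₄_nat_three_mod_four (by omega)
  · exact ZMod.χ₄_nat_one_mod_four (by omega)

theorem odd_div_two_pow_padicValNat {n : ℕ} (hn : n ≠ 0) : Odd (n / 2 ^ padicValNat 2 n) := by
  rw [← Nat.not_even_iff_odd, even_iff_two_dvd, ← Nat.factorization_def n Nat.prime_two]
  exact Nat.not_dvd_ordCompl Nat.prime_two hn

theorem kroneckerSym_eq_jacobiSym_natAbs {d : ℤ} (hd : d % 4 = 1) (a : ℤ) :
    kroneckerSym d a = J(a | d.natAbs) := by
  have hdodd : Odd d := Int.odd_iff.mpr (by omega)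
  rcases eq_or_ne a 0 with rfl | ha0
  · rw [kroneckerSym, if_pos rfl]
    split_ifs with hd1
    · rw [hd1, Int.natAbs_one, jacobiSym.one_right]
    · rw [jacobiSym.zero_left (by omega)]
  set v := padicValNat 2 a.natAbs with hv
  set m := a.natAbs / 2 ^ v with hm
  have hmodd : Odd m := odd_div_two_pow_padicValNat (Int.natAbs_ne_zero.mpr ha0)
  have habs : a.natAbs = 2 ^ v * m := (Nat.mul_div_cancel' pow_padicValNat_dvd).symm
  have hJ : J(a.natAbs | d.natAbs) = J(2 | d.natAbs) ^ v * J(m | d.natAbs) := by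
    rw [habs, Nat.cast_mul, Nat.cast_pow, jacobiSym.mul_left, jacobiSym.pow_left, Nat.cast_ofNat]
  rw [kroneckerSym, if_neg ha0, ← hv, ← hm, χ₈_eq_jacobiSym_two hdodd,
    jacobiSym_eq_jacobiSym_natAbs hd hmodd, mul_assoc, ← hJ]
  rcases lt_or_gt_of_ne ha0 with hneg | hpos
  · have hneg_abs : a = -1 * (a.natAbs : ℤ) := by omega
    conv_rhs => rw [hneg_abs, jacobiSym.mul_left, jacobiSym_neg_one_natAbs hd]
    simp only [hneg, true_and]
  · rw [if_neg (by omega), one_mul, Int.natAbs_of_nonneg hpos.le]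

theorem kroneckerSym_congr {d : ℤ} (hd : d % 4 = 0 ∨ d % 4 = 1) {a b : ℤ} (h : a ≡ b [ZMOD d]) :
    kroneckerSym d a = kroneckerSym d b := by
  rcases hd with hd | hd
  · rcases eq_or_ne d 0 with rfl | hd0
    · rw [Int.modEq_zero_iff.mp h]
    have hparity : Odd a ↔ Odd b := by
      have h2 := h.of_dvd (show (2 : ℤ) ∣ d by omega)
      rw [Int.odd_iff, Int.odd_iff, h2]
    by_cases ha : Odd a
    · have hres : ((a % d).toNat : ℤ) ≡ a [ZMOD d] := by
        rw [Int.toNat_of_nonneg (Int.emod_nonneg a hd0)]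
        exact Int.mod_modEq a d
      rw [kroneckerSym_eq_jacobiSym_of_modEq hd hd0 ha hres,
        kroneckerSym_eq_jacobiSym_of_modEq hd hd0 (hparity.mp ha) (hres.trans h)]
    · have hd2 : Even d := Int.even_iff.mpr (by omega)
      rw [kroneckerSym_of_even hd2 (Int.not_odd_iff_even.mp ha),
        kroneckerSym_of_even hd2 (Int.not_odd_iff_even.mp (hparity.not.mp ha))]
  · rw [kroneckerSym_eq_jacobiSym_natAbs hd, kroneckerSym_eq_jacobiSym_natAbs hd]
    refine jacobiSym.mod_left' ?_
    rw [Int.natCast_natAbs, Int.emod_abs, Int.emod_abs]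
    exact h

end KroneckerSymbol

section SignTransfer

open Equiv

theorem card_eq_of_surjective_of_ker_eq {X A B : Type*} {f : X → A} {g : X → B}
    (hf : Function.Surjective f) (hg : Function.Surjective g)
    (h : ∀ x y, f x = f y ↔ g x = g y) : Nat.card A = Nat.card B := by
  have hker : Setoid.ker f = Setoid.ker g := Setoid.ext h
  refine Nat.card_congr ((Setoid.quotientKerEquivOfSurjective f hf).symm.trans ?_)
  rw [hker]
  exact Setoid.quotientKerEquivOfSurjective g hg

theorem card_quotient_sameCycle {X : Type*} [Fintype X] [DecidableEq X] (σ : Perm X) :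
    Nat.card (Quotient (Perm.SameCycle.setoid σ)) =
      σ.cycleType.card + Fintype.card (Function.fixedPoints σ) := by
  let f : X → σ.cycleFactorsFinset ⊕ Function.fixedPoints σ := fun x ↦
    if hx : σ x = x then .inr ⟨x, hx⟩
    else .inl ⟨σ.cycleOf x, Perm.cycleOf_mem_cycleFactorsFinset_iff.mpr (Perm.mem_support.mpr hx)⟩
  have hf : Function.Surjective f := by
    rintro (⟨c, hc⟩ | ⟨x, hx⟩)
    · obtain ⟨x, hx⟩ := (Perm.mem_cycleFactorsFinset_iff.mp hc).1.nonempty_support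
      have hxσ : σ x ≠ x := Perm.mem_support.mp (Perm.mem_cycleFactorsFinset_support_le hc hx)
      refine ⟨x, ?_⟩
      simp only [f, dif_neg hxσ]
      exact congrArg Sum.inl (Subtype.ext
        ((Perm.eq_cycleOf_of_mem_cycleFactorsFinset_iff σ c hc x).mpr hx).symm)
    · exact ⟨x, dif_pos hx⟩
  have hker : ∀ x y, Quotient.mk (Perm.SameCycle.setoid σ) x = Quotient.mk _ y ↔ f x = f y := by
    intro x y
    rw [Quotient.eq]
    change σ.SameCycle x y ↔ f x = f y
    by_cases hx : σ x = x <;> by_cases hy : σ y = y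
    · simp only [f, dif_pos hx, dif_pos hy, Sum.inr.injEq]
      exact ⟨fun h ↦ Subtype.ext (h.eq_of_left hx), fun h ↦ by rw [Subtype.mk.inj h]⟩
    · simp only [f, dif_pos hx, dif_neg hy, reduceCtorEq, iff_false]
      exact fun h ↦ hy (h.apply_eq_self_iff.mp hx)
    · simp only [f, dif_neg hx, dif_pos hy, reduceCtorEq, iff_false]
      exact fun h ↦ hx (h.apply_eq_self_iff.mpr hy)
    · simp only [f, dif_neg hx, dif_neg hy, Sum.inl.injEq, Subtype.mk.injEq]
      exact Perm.sameCycle_iff_cycleOf_eq_of_mem_support (Perm.mem_support.mpr hx)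
        (Perm.mem_support.mpr hy)
  rw [card_eq_of_surjective_of_ker_eq Quotient.mk_surjective hf hker, Nat.card_sum,
    Nat.card_eq_fintype_card, Nat.card_eq_fintype_card, Fintype.card_coe, Perm.cycleType_def,
    Multiset.card_map, Finset.card_def]

theorem sign_eq_neg_one_pow_card_add_card_cycles {X : Type*} [Fintype X] [DecidableEq X]
    (σ : Perm X) :
    Perm.sign σ = (-1) ^ (Nat.card X + Nat.card (Quotient (Perm.SameCycle.setoid σ))) := by
  have hfix := Perm.card_fixedPoints σ
  rw [Perm.sign_of_cycleType, card_quotient_sameCycle, Nat.card_eq_fintype_card]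
  have hle : σ.cycleType.sum ≤ Fintype.card X := by
    rw [Perm.sum_cycleType]
    exact σ.support.card_le_univ
  rw [show Fintype.card X + (σ.cycleType.card + Fintype.card (Function.fixedPoints σ)) =
    σ.cycleType.sum + σ.cycleType.card + 2 * Fintype.card (Function.fixedPoints σ) by omega,
    pow_add _ _ (2 * _), pow_mul, neg_one_sq, one_pow, mul_one]

section OddOrbits

variable {H X Y : Type*} [Group H] [MulAction H X]

theorem card_modEq_card_orbits [Finite X]
    (hodd : ∀ x : X, Odd (MulAction.stabilizer H x).index) :
    Nat.card X ≡ Nat.card (MulAction.orbitRel.Quotient H X) [MOD 2] := by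
  have := Fintype.ofFinite (MulAction.orbitRel.Quotient H X)
  rw [Nat.card_congr (MulAction.selfEquivSigmaOrbits H X), Nat.card_sigma,
    Nat.card_eq_fintype_card, Fintype.card, Finset.card_eq_sum_ones]
  refine Nat.ModEq.sum fun ω _ ↦ ?_
  rw [Nat.card_coe_set_eq, ← MulAction.index_stabilizer]
  exact Nat.odd_iff.mp (hodd ω.out)

theorem card_modEq_card_of_fibers_eq_orbits [Finite X]
    (hodd : ∀ x : X, Odd (MulAction.stabilizer H x).index) {π : X → Y}
    (hπ : Function.Surjective π) (hfib : ∀ x y, π x = π y ↔ x ∈ MulAction.orbit H y) :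
    Nat.card X ≡ Nat.card Y [MOD 2] := by
  refine (card_modEq_card_orbits hodd).trans (congrArg (· % 2) ?_)
  refine card_eq_of_surjective_of_ker_eq Quotient.mk_surjective hπ fun x y ↦ ?_
  rw [hfib, Quotient.eq, MulAction.orbitRel_apply]

theorem stabilizer_le_stabilizer_apply [MulAction H Y] (f : X →[H] Y) (x : X) :
    MulAction.stabilizer H x ≤ MulAction.stabilizer H (f x) := fun c hc ↦ by
  rw [MulAction.mem_stabilizer_iff] at hc ⊢
  rw [← map_smul, hc]

variable {σ : Perm X}

/-- The action of `H` on the cycles of a permutation `σ` that commutes with the action of `H`. -/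
abbrev cyclesMulAction (hσ : ∀ (c : H) x, σ (c • x) = c • σ x) :
    MulAction H (Quotient (Perm.SameCycle.setoid σ)) where
  smul c := Quotient.map (c • ·) fun x y ⟨i, hi⟩ ↦ ⟨i, by
    have hcomm : Commute σ (MulAction.toPerm c) := Equiv.ext (hσ c)
    rw [← hi]; exact Equiv.congr_fun (hcomm.zpow_left i) x⟩
  one_smul := by rintro ⟨x⟩; exact congrArg (Quotient.mk _) (one_smul H x)
  mul_smul := by rintro c d ⟨x⟩; exact congrArg (Quotient.mk _) (mul_smul c d x)

variable {τ : Perm Y} {π : X → Y}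

theorem semiconj_zpow (hστ : Function.Semiconj π σ τ) (i : ℤ) :
    Function.Semiconj π ⇑(σ ^ i) ⇑(τ ^ i) := by
  have hpow (n : ℕ) : Function.Semiconj π ⇑(σ ^ n) ⇑(τ ^ n) := by
    simpa only [Perm.iterate_eq_pow] using hστ.iterate_right n
  obtain ⟨n, rfl | rfl⟩ := i.eq_nat_or_neg
  · simpa only [zpow_natCast] using hpow n
  · rw [zpow_neg, zpow_neg, zpow_natCast, zpow_natCast]
    exact (hpow n).inverses_right (σ ^ n).apply_symm_apply (τ ^ n).symm_apply_apply

theorem card_cycles_modEq_card_cycles [Finite X]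
    (hodd : ∀ x : X, Odd (MulAction.stabilizer H x).index) (hπ : Function.Surjective π)
    (hfib : ∀ x y, π x = π y ↔ x ∈ MulAction.orbit H y)
    (hσ : ∀ (c : H) x, σ (c • x) = c • σ x) (hστ : Function.Semiconj π σ τ) :
    Nat.card (Quotient (Perm.SameCycle.setoid σ)) ≡
      Nat.card (Quotient (Perm.SameCycle.setoid τ)) [MOD 2] := by
  let := cyclesMulAction hσ
  let cycle : X →[H] Quotient (Perm.SameCycle.setoid σ) := ⟨Quotient.mk _, fun _ _ ↦ rfl⟩
  have hcycle : Function.Surjective cycle := Quotient.mk_surjective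
  have hodd_cycles : ∀ C : Quotient (Perm.SameCycle.setoid σ),
      Odd (MulAction.stabilizer H C).index := by
    refine hcycle.forall.mpr fun x ↦ (hodd x).of_dvd_nat ?_
    exact Subgroup.index_dvd_of_le (stabilizer_le_stabilizer_apply cycle x)
  refine (card_modEq_card_orbits hodd_cycles).trans (congrArg (· % 2) ?_)
  refine card_eq_of_surjective_of_ker_eq (f := Quotient.mk _ ∘ cycle) (g := Quotient.mk _ ∘ π)
    (Quotient.mk_surjective.comp hcycle) (Quotient.mk_surjective.comp hπ) fun x y ↦ ?_
  simp only [Function.comp_apply, Quotient.eq, MulAction.orbitRel_apply]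
  constructor
  · rintro ⟨c, hc⟩
    obtain ⟨i, hi⟩ : σ.SameCycle (c • y) x := Quotient.exact hc
    refine Perm.SameCycle.symm ⟨i, ?_⟩
    rw [← (hfib (c • y) y).mpr ⟨c, rfl⟩, ← semiconj_zpow hστ i, hi]
  · rintro ⟨i, hi⟩
    rw [← semiconj_zpow hστ i, hfib] at hi
    obtain ⟨c, hc⟩ := hi
    exact ⟨c, Quotient.sound (Perm.SameCycle.symm ⟨i, hc.symm⟩)⟩

theorem sign_eq_sign_of_odd_orbits [Fintype X] [DecidableEq X] [Fintype Y] [DecidableEq Y]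
    (hodd : ∀ x : X, Odd (MulAction.stabilizer H x).index) (hπ : Function.Surjective π)
    (hfib : ∀ x y, π x = π y ↔ x ∈ MulAction.orbit H y)
    (hσ : ∀ (c : H) x, σ (c • x) = c • σ x) (hστ : Function.Semiconj π σ τ) :
    Perm.sign σ = Perm.sign τ := by
  have hcard := (card_modEq_card_of_fibers_eq_orbits hodd hπ hfib).add
    (card_cycles_modEq_card_cycles hodd hπ hfib hσ hστ)
  rw [sign_eq_neg_one_pow_card_add_card_cycles, sign_eq_neg_one_pow_card_add_card_cycles,
    pow_eq_pow_mod _ neg_one_sq, hcard, ← pow_eq_pow_mod _ neg_one_sq]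

end OddOrbits

section ConjugacyClasses

variable {G : Type*} [Group G]

/-- The permutation of the conjugacy classes of `G` induced by a permutation of `G` that commutes
with conjugation. -/
def conjClassesPerm (σ : Perm G) (hσ : ∀ c g, σ (c * g * c⁻¹) = c * σ g * c⁻¹) :
    Perm (ConjClasses G) :=
  Quotient.congr σ fun x y ↦ by
    change IsConj x y ↔ IsConj (σ x) (σ y)
    simp only [isConj_iff, ← hσ, σ.injective.eq_iff]

theorem inv_conj (c g : G) : Equiv.inv G (c * g * c⁻¹) = c * Equiv.inv G g * c⁻¹ :=
  conj_inv

variable (G) in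
/-- Inversion `C ↦ C⁻¹` of conjugacy classes. -/
def conjClassesInv : Perm (ConjClasses G) :=
  conjClassesPerm (Equiv.inv G) inv_conj

theorem sign_conjClassesPerm [Fintype G] [DecidableEq G] [Fintype (ConjClasses G)]
    [DecidableEq (ConjClasses G)] (hG : Odd (Subgroup.center G).index) {σ : Perm G}
    (hσ : ∀ c g, σ (c * g * c⁻¹) = c * σ g * c⁻¹) :
    Perm.sign (conjClassesPerm σ hσ) = Perm.sign σ := by
  have hodd (g : G) : Odd (MulAction.stabilizer (ConjAct G) g).index := by
    rw [ConjAct.stabilizer_eq_centralizer]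
    exact hG.of_dvd_nat (Subgroup.index_dvd_of_le (Subgroup.center_le_centralizer _))
  have hfib (x y : G) :
      ConjClasses.mk x = ConjClasses.mk y ↔ x ∈ MulAction.orbit (ConjAct G) y := by
    rw [ConjClasses.mk_eq_mk_iff_isConj, ConjAct.mem_orbit_conjAct]
  exact (sign_eq_sign_of_odd_orbits hodd ConjClasses.mk_surjective hfib
    (fun c g ↦ hσ (ConjAct.ofConjAct c) g) fun g ↦ rfl).symm

end ConjugacyClasses

end SignTransfer

section CharacterTable

open Polynomial Matrix

theorem expand_charpoly_pow_char {n R : Type*} [DecidableEq n] [Fintype n] [CommRing R] (p : ℕ)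
    [Fact p.Prime] [CharP R p] (M : Matrix n n R) :
    expand R p (M ^ p).charpoly = M.charpoly ^ p := by
  cases isEmpty_or_nonempty n
  · simp [charpoly]
  unfold charpoly
  rw [AlgHom.map_det, ← coe_detMonoidHom, ← (detMonoidHom : Matrix n n R[X] →* R[X]).map_pow]
  refine congrArg det (matPolyEquiv.injective ?_)
  rw [map_pow, matPolyEquiv_charmatrix, sub_pow_char_of_commute, ← C_pow]
  · exact matPolyEquiv_eq_X_pow_sub_C p M
  · exact (C M).commute_X

theorem trace_pow_char {n R : Type*} [DecidableEq n] [Fintype n] [CommRing R] (p : ℕ)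
    [Fact p.Prime] [CharP R p] (M : Matrix n n R) : trace (M ^ p) = trace M ^ p := by
  have hp : p.Prime := Fact.out
  have : Nontrivial R := CharP.nontrivial_of_char_ne_one hp.ne_one
  cases isEmpty_or_nonempty n
  · simp [trace, hp.ne_zero]
  have hcharpoly : (M ^ p).charpoly = M.charpoly.map (frobenius R p) := by
    refine expand_injective hp.pos ?_
    rw [expand_charpoly_pow_char, ← map_expand, map_frobenius_expand]
  rw [trace_eq_neg_charpoly_coeff, trace_eq_neg_charpoly_coeff, hcharpoly, coeff_map,
    ← map_neg, frobenius_def]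

theorem trace_mulLeftRight_pi {ι R : Type*} {n : ι → Type*} [Fintype ι] [∀ i, Fintype (n i)]
    [CommRing R] (A B : Π i, Matrix (n i) (n i) R) :
    LinearMap.trace R (Π i, Matrix (n i) (n i) R) (LinearMap.mulLeftRight R (A, B)) =
      ∑ i, trace (A i) * trace (B i) := by
  classical
  rw [LinearMap.trace_eq_matrix_trace R (Pi.basis fun i ↦ Matrix.stdBasis R (n i) (n i))]
  simp only [trace, diag, Fintype.sum_sigma, Fintype.sum_prod_type, Finset.sum_mul_sum,
    LinearMap.toMatrix_apply]
  refine Finset.sum_congr rfl fun i _ ↦ Finset.sum_congr rfl fun a _ ↦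
    Finset.sum_congr rfl fun b _ ↦ ?_
  simp only [Pi.basis_apply, Matrix.stdBasis_eq_single, LinearMap.mulLeftRight_apply,
    Pi.basis_repr, Pi.mul_apply, Pi.single_eq_same]
  change (A i * single a b 1 * B i : Matrix (n i) (n i) R) a b = _
  simp [Matrix.mul_apply, single_apply, Finset.sum_ite_eq, ite_and]

theorem trace_mulLeftRight_single {G R : Type*} [Group G] [Finite G] [CommRing R] (g h : G) :
    LinearMap.trace R (MonoidAlgebra R G)
      (LinearMap.mulLeftRight R (MonoidAlgebra.single g 1, MonoidAlgebra.single h 1)) =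
    Nat.card {x // g * x * h = x} := by
  classical
  have := Fintype.ofFinite G
  rw [LinearMap.trace_eq_matrix_trace R (MonoidAlgebra.basis G R)]
  simp [trace, LinearMap.toMatrix_apply, MonoidAlgebra.basis, Finsupp.single_apply,
    Fintype.card_subtype]

section Centralizers

variable {G : Type*} [Group G]

/-- The order of the centralizer of a representative of a conjugacy class. -/
noncomputable def classCentralizerCard (C : ConjClasses G) : ℕ :=
  Nat.card (Subgroup.centralizer {C.out})

theorem card_centralizer_eq_of_isConj {g h : G} (hgh : IsConj g h) :
    Nat.card (Subgroup.centralizer {g}) = Nat.card (Subgroup.centralizer {h}) := by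
  obtain ⟨c, rfl⟩ := isConj_iff.mp hgh
  refine Nat.card_congr ((MulAut.conj c).toEquiv.subtypeEquiv fun x ↦ ?_)
  rw [Subgroup.mem_centralizer_singleton_iff, Subgroup.mem_centralizer_singleton_iff,
    ← (MulAut.conj c).injective.eq_iff, map_mul, map_mul]
  rfl

theorem classCentralizerCard_mk (g : G) :
    classCentralizerCard (ConjClasses.mk g) = Nat.card (Subgroup.centralizer {g}) :=
  card_centralizer_eq_of_isConj
    (ConjClasses.mk_eq_mk_iff_isConj.mp (Quotient.out_eq (ConjClasses.mk g)))

theorem classCentralizerCard_dvd_card (C : ConjClasses G) :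
    classCentralizerCard C ∣ Nat.card G :=
  Subgroup.card_subgroup_dvd_card _

theorem classCentralizerCard_ne_zero {R : Type*} [Semiring R] (hG : (Nat.card G : R) ≠ 0)
    (C : ConjClasses G) : (classCentralizerCard C : R) ≠ 0 := by
  obtain ⟨m, hm⟩ := classCentralizerCard_dvd_card C
  intro h
  rw [hm, Nat.cast_mul, h, zero_mul] at hG
  exact hG rfl

theorem classCentralizerCard_mk_inv (g : G) :
    classCentralizerCard (ConjClasses.mk g⁻¹) = classCentralizerCard (ConjClasses.mk g) := by
  rw [classCentralizerCard_mk, classCentralizerCard_mk]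
  refine Nat.card_congr (Equiv.subtypeEquivRight fun x ↦ ?_)
  simp only [Subgroup.mem_centralizer_singleton_iff]
  exact Commute.inv_right_iff

theorem card_setOf_mul_mul_inv_eq [DecidableEq (ConjClasses G)] (g h : G) :
    Nat.card {x : G // g * x * h⁻¹ = x} =
      if ConjClasses.mk g = .mk h then classCentralizerCard (.mk g) else 0 := by
  split_ifs with hgh
  · obtain ⟨c, rfl⟩ := isConj_iff.mp (ConjClasses.mk_eq_mk_iff_isConj.mp hgh)
    rw [classCentralizerCard_mk]
    refine Nat.card_congr ((Equiv.mulRight c).subtypeEquiv fun x ↦ ?_)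
    rw [Subgroup.mem_centralizer_singleton_iff, Equiv.coe_mulRight, mul_inv_eq_iff_eq_mul,
      ← mul_left_inj c]
    simp only [mul_assoc, inv_mul_cancel, mul_one]
    exact eq_comm
  · have : IsEmpty {x : G // g * x * h⁻¹ = x} := ⟨fun ⟨x, hx⟩ ↦ hgh ?_⟩
    · exact Nat.card_of_isEmpty
    · rw [ConjClasses.mk_eq_mk_iff_isConj, isConj_comm, isConj_iff]
      exact ⟨x, by rw [mul_inv_eq_iff_eq_mul] at hx ⊢; exact hx.symm⟩

end Centralizers

section Blocks

variable {G K ι : Type*} {n : ι → Type*} [Group G] [Field K] [∀ i, Fintype (n i)]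
  [∀ i, DecidableEq (n i)]

/-- The character table of `G` read off from a Wedderburn decomposition `e` of the group algebra:
the `i`-th row is the class function `g ↦ trace (e g i)`. -/
noncomputable def characterTable (e : MonoidAlgebra K G ≃ₐ[K] Π i, Matrix (n i) (n i) K) :
    Matrix ι (ConjClasses G) K :=
  of fun i C ↦ trace (e (MonoidAlgebra.single C.out 1) i)

variable (e : MonoidAlgebra K G ≃ₐ[K] Π i, Matrix (n i) (n i) K)

theorem trace_apply_single_eq_of_isConj {g h : G} (hgh : IsConj g h) (i : ι) :
    trace (e (MonoidAlgebra.single g 1) i) = trace (e (MonoidAlgebra.single h 1) i) := by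
  obtain ⟨c, rfl⟩ := isConj_iff.mp hgh
  have hconj : (MonoidAlgebra.single (c * g * c⁻¹) 1 : MonoidAlgebra K G) =
      .single c 1 * .single g 1 * .single c⁻¹ 1 := by simp
  rw [hconj, map_mul, Pi.mul_apply, trace_mul_comm, ← Pi.mul_apply, ← map_mul]
  simp [← mul_assoc]

theorem characterTable_mk (i : ι) (g : G) :
    characterTable e i (ConjClasses.mk g) = trace (e (MonoidAlgebra.single g 1) i) :=
  trace_apply_single_eq_of_isConj e
    (ConjClasses.mk_eq_mk_iff_isConj.mp (Quotient.out_eq (ConjClasses.mk g))) i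

theorem characterTable_mk_pow_char (p : ℕ) [Fact p.Prime] [CharP K p] (i : ι) (g : G) :
    characterTable e i (ConjClasses.mk (g ^ p)) = characterTable e i (ConjClasses.mk g) ^ p := by
  rw [characterTable_mk, characterTable_mk, ← trace_pow_char, ← Pi.pow_apply, ← map_pow,
    MonoidAlgebra.single_pow, one_pow]

theorem linearIndependent_characterTable [∀ i, Nonempty (n i)] [Finite ι] :
    LinearIndependent K (characterTable e).row := by
  classical
  have := Fintype.ofFinite ι
  rw [Fintype.linearIndependent_iff]
  intro c hc j
  let φ : (Π i, Matrix (n i) (n i) K) →ₗ[K] K :=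
    ∑ i, c i • (traceLinearMap (n i) K K ∘ₗ LinearMap.proj i)
  have hφ_apply (A : Π i, Matrix (n i) (n i) K) : φ A = ∑ i, c i * trace (A i) := by simp [φ]
  have hφ_zero : φ ∘ₗ e.toLinearMap = 0 := by
    refine (MonoidAlgebra.basis G K).ext fun g ↦ ?_
    have hcol : ∑ i, c i * characterTable e i (ConjClasses.mk g) = 0 := by
      simpa using congrFun hc (.mk g)
    simpa [hφ_apply, characterTable_mk] using hcol
  obtain ⟨a⟩ : Nonempty (n j) := inferInstance
  have hj := LinearMap.congr_fun hφ_zero (e.symm (Pi.single j (single a a 1)))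
  rw [LinearMap.comp_apply, AlgEquiv.toLinearMap_apply, AlgEquiv.apply_symm_apply, hφ_apply,
    Finset.sum_eq_single j] at hj
  · simpa using hj
  · intro i _ hij
    rw [Pi.single_eq_of_ne hij, trace_zero, mul_zero]
  · simp

variable [Fintype ι] [Finite G]

theorem sum_characterTable_mul_inv [DecidableEq (ConjClasses G)] (g h : G) :
    ∑ i, characterTable e i (ConjClasses.mk g) * characterTable e i (ConjClasses.mk h⁻¹) =
      if ConjClasses.mk g = .mk h then (classCentralizerCard (.mk g) : K) else 0 := by
  have htrace := trace_mulLeftRight_single (R := K) g h⁻¹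
  rw [← LinearMap.trace_conj' _ e.toLinearEquiv, AlgEquiv.linearEquivConj_mulLeftRight,
    card_setOf_mul_mul_inv_eq] at htrace
  simp only [characterTable_mk]
  rw [← trace_mulLeftRight_pi]
  refine htrace.trans ?_
  split_ifs <;> simp

theorem transpose_characterTable_mul [DecidableEq (ConjClasses G)] :
    (characterTable e)ᵀ * (characterTable e).submatrix id (conjClassesInv G) =
      diagonal fun C ↦ (classCentralizerCard C : K) := by
  ext C D
  obtain ⟨g, rfl⟩ := ConjClasses.mk_surjective C
  obtain ⟨h, rfl⟩ := ConjClasses.mk_surjective D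
  exact sum_characterTable_mul_inv e g h

variable [Fintype (ConjClasses G)]

theorem card_blocks_eq_card_conjClasses [∀ i, Nonempty (n i)]
    (e : MonoidAlgebra K G ≃ₐ[K] Π i, Matrix (n i) (n i) K) (hG : (Nat.card G : K) ≠ 0) :
    Fintype.card ι = Fintype.card (ConjClasses G) := by
  classical
  rw [← (linearIndependent_characterTable e).rank_matrix]
  refine le_antisymm (rank_le_card_width _) ?_
  have hrank : (diagonal fun C : ConjClasses G ↦ (classCentralizerCard C : K)).rank =
      Fintype.card (ConjClasses G) :=
    rank_of_isUnit _ (isUnit_diagonal.mpr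
      (Pi.isUnit_iff.mpr fun C ↦ (classCentralizerCard_ne_zero hG C).isUnit))
  rw [← hrank, ← transpose_characterTable_mul e, ← rank_transpose (characterTable e)]
  exact rank_mul_le_left _ _

end Blocks

theorem sign_mul_prod_pow_eq_sign {m K : Type*} [Fintype m] [DecidableEq m] [CommRing K]
    [IsDomain K] {p : ℕ} [Fact p.Prime] [CharP K p] (hp2 : p ≠ 2) {X : Matrix m m K} {c : m → K}
    (hc : ∀ i, c i ≠ 0) {σ τ : Equiv.Perm m} (hσ : Xᵀ * X.submatrix id σ = diagonal c)
    (hτ : X.map (frobenius K p) = X.submatrix id τ) :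
    (((Equiv.Perm.sign σ : ℤˣ) : ℤ) * ∏ i, c i : K) ^ (p / 2) =
      ((Equiv.Perm.sign τ : ℤˣ) : ℤ) := by
  have hp : 2 * (p / 2) + 1 = p :=
    Nat.two_mul_div_two_add_one_of_odd ((Fact.out : p.Prime).odd_of_ne_two hp2)
  have hdet_mul : X.det * (((Equiv.Perm.sign σ : ℤˣ) : ℤ) * X.det) = ∏ i, c i := by
    rw [← det_permute', ← det_transpose X, ← det_mul, hσ, det_diagonal]
  have hdet_pow : X.det ^ p = ((Equiv.Perm.sign τ : ℤˣ) : ℤ) * X.det := by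
    rw [← det_permute', ← hτ, ← RingHom.mapMatrix_apply, ← RingHom.map_det, frobenius_def]
  have hdet : X.det ≠ 0 := by
    intro h
    rw [h, zero_mul] at hdet_mul
    exact Finset.prod_ne_zero_iff.mpr (fun i _ ↦ hc i) hdet_mul.symm
  have hsign : (((Equiv.Perm.sign σ : ℤˣ) : ℤ) : K) * ((Equiv.Perm.sign σ : ℤˣ) : ℤ) = 1 := by
    rw [← Int.cast_mul, Int.units_coe_mul_self, Int.cast_one]
  have hdet_sq : ((Equiv.Perm.sign σ : ℤˣ) : ℤ) * ∏ i, c i = X.det ^ 2 := by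
    rw [← hdet_mul]
    linear_combination X.det ^ 2 * hsign
  refine mul_right_cancel₀ hdet ?_
  rw [hdet_sq, ← pow_mul, ← pow_succ, hp, hdet_pow]

theorem legendreSym_eq_of_pow_eq {R : Type*} [CommRing R] {p : ℕ} [Fact p.Prime] [CharP R p]
    (hp2 : p ≠ 2) {m : ℤ} {s : ℤˣ} (h : (m : R) ^ (p / 2) = ((s : ℤ) : R)) :
    legendreSym p m = s := by
  have : Nontrivial R := CharP.nontrivial_of_char_ne_one (Fact.out : p.Prime).ne_one
  have : Fact (2 < p) := ⟨(Fact.out : p.Prime).two_le.lt_of_ne' hp2⟩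
  have hpow : (m : ZMod p) ^ (p / 2) = ((s : ℤ) : ZMod p) := by
    refine (ZMod.castHom (dvd_refl p) R).injective ?_
    rwa [map_pow, map_intCast, map_intCast]
  rw [← legendreSym.eq_pow] at hpow
  have hne := ZMod.neg_one_ne_one (n := p)
  rcases quadraticChar_isQuadratic (ZMod p) m with hm | hm | hm <;>
    rcases Int.units_eq_one_or s with rfl | rfl <;>
    simp_all [legendreSym, eq_comm]

theorem legendreSym_sign_mul_prod_classCentralizerCard {G : Type*} [Group G] [Finite G]
    [Fintype (ConjClasses G)] [DecidableEq (ConjClasses G)] {p : ℕ} [Fact p.Prime] (hp2 : p ≠ 2)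
    (hp : ¬ p ∣ Nat.card G) {τ : Equiv.Perm (ConjClasses G)} (hτ : ∀ g, τ (.mk g) = .mk (g ^ p)) :
    legendreSym p ((Equiv.Perm.sign (conjClassesInv G) : ℤˣ) *
        ∏ C : ConjClasses G, (classCentralizerCard C : ℤ)) =
      (Equiv.Perm.sign τ : ℤˣ) := by
  let K := AlgebraicClosure (ZMod p)
  have : CharP K p := charP_of_injective_algebraMap (algebraMap (ZMod p) K).injective p
  have hG : (Nat.card G : K) ≠ 0 := by rwa [Ne, CharP.cast_eq_zero_iff K p]
  have : NeZero (Nat.card G : K) := ⟨hG⟩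
  obtain ⟨r, n, hn, ⟨e⟩⟩ :=
    IsSemisimpleRing.exists_algEquiv_pi_matrix_of_isAlgClosed K (MonoidAlgebra K G)
  let E : ConjClasses G ≃ Fin r :=
    Fintype.equivOfCardEq (card_blocks_eq_card_conjClasses e hG).symm
  let X := (characterTable e).submatrix E id
  have horth : Xᵀ * X.submatrix id (conjClassesInv G) =
      diagonal fun C ↦ (classCentralizerCard C : K) := by
    rw [← transpose_characterTable_mul e]
    exact submatrix_mul_equiv (characterTable e)ᵀ
      ((characterTable e).submatrix id (conjClassesInv G)) id E id
  have hfrob : X.map (frobenius K p) = X.submatrix id τ := by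
    ext i D
    obtain ⟨g, rfl⟩ := ConjClasses.mk_surjective D
    change frobenius K p (characterTable e (E i) (.mk g)) = characterTable e (E i) (τ (.mk g))
    rw [hτ, characterTable_mk_pow_char, frobenius_def]
  refine legendreSym_eq_of_pow_eq (R := K) hp2 ?_
  rw [Int.cast_mul, Int.cast_prod]
  simp only [Int.cast_natCast]
  exact sign_mul_prod_pow_eq_sign hp2 (classCentralizerCard_ne_zero hG) horth hfrob

end CharacterTable

theorem prod_eq_prod_fixed_of_involutive {α M : Type*} [Fintype α] [DecidableEq α] [CommMonoid M]
    {f : α → M} {σ : α → α} (hσ : Function.Involutive σ)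
    (hf : ∀ x, σ x ≠ x → f x * f (σ x) = 1) : ∏ x, f x = ∏ x with σ x = x, f x := by
  rw [← Finset.prod_filter_mul_prod_filter_not Finset.univ (fun x ↦ σ x = x),
    Finset.prod_involution (s := {x | ¬ σ x = x}) (fun x _ ↦ σ x), mul_one]
  · exact fun x hx ↦ hf x (Finset.mem_filter.mp hx).2
  · exact fun x hx _ ↦ (Finset.mem_filter.mp hx).2
  · intro x hx
    simpa [hσ x, eq_comm] using hx
  · exact fun x _ ↦ hσ x

theorem neg_one_pow_mul_emod_four (k : ℕ) : (-1) ^ k * (2 * k + 1 : ℤ) % 4 = 1 := by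
  rcases k.even_or_odd' with ⟨j, rfl | rfl⟩
  · rw [(even_two_mul j).neg_one_pow]
    push_cast
    omega
  · rw [(odd_two_mul_add_one j).neg_one_pow]
    push_cast
    omega

theorem isCoprime_of_modEq {a b n : ℤ} (ha : IsCoprime a n) (hab : a ≡ b [ZMOD n]) :
    IsCoprime b n := by
  obtain ⟨t, rfl⟩ := Int.modEq_iff_add_fac.mp hab
  exact ha.add_mul_left_left t

section OddCentralIndex

variable {G : Type*} [Group G]

theorem odd_index_center (hG : (∀ x y : G, x * y = y * x) ∨ Odd (Nat.card G)) :
    Odd (Subgroup.center G).index := by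
  rcases hG with hcomm | hodd
  · have htop : Subgroup.center G = ⊤ :=
      eq_top_iff.mpr fun z _ ↦ Subgroup.mem_center_iff.mpr fun g ↦ hcomm g z
    rw [htop, Subgroup.index_top]
    exact odd_one
  · exact hodd.of_dvd_nat (Subgroup.index_dvd_card _)

theorem mem_center_of_sq_eq_one (hG : Odd (Subgroup.center G).index) {g : G} (hg : g ^ 2 = 1) :
    g ∈ Subgroup.center G := by
  obtain ⟨k, hk⟩ := hG
  have hpow := Subgroup.pow_index_mem (Subgroup.center G) g
  rwa [hk, pow_succ, pow_mul, hg, one_pow, one_mul] at hpow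

theorem powKernel_two_subset_center (hG : Odd (Subgroup.center G).index) :
    powKernel G 2 ⊆ Subgroup.center G :=
  fun _ hg ↦ mem_center_of_sq_eq_one hG hg

theorem sq_eq_one_of_isConj_inv (hG : Odd (Subgroup.center G).index) {g : G}
    (hg : IsConj g g⁻¹) : g ^ 2 = 1 := by
  obtain ⟨c, hc⟩ := hg
  obtain ⟨k, hk⟩ := hG
  have hc_sq : Commute ((c : G) ^ 2) g := by
    have h := hc.inv_right.mul_left hc
    rwa [inv_inv, ← sq] at h
  have hc_odd : SemiconjBy ((c : G) ^ (2 * k + 1)) g g⁻¹ := by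
    rw [pow_succ, pow_mul]
    exact SemiconjBy.mul_left (hc_sq.pow_left k).inv_right hc
  have hcentral := Subgroup.mem_center_iff.mp (Subgroup.pow_index_mem (Subgroup.center G) (c : G)) g
  rw [hk, hc_odd.eq, mul_left_inj] at hcentral
  rw [sq, mul_eq_one_iff_eq_inv]
  exact hcentral

theorem numSylowTwo_eq_one [Finite G] (hG : Odd (Subgroup.center G).index) :
    numSylowTwo G = 1 := by
  have P : Sylow 2 G := default
  have hP_le : (P : Subgroup G) ≤ Subgroup.center G := by
    obtain ⟨k, hk⟩ := IsPGroup.iff_card.mp P.isPGroup'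
    have hcoprime : Nat.Coprime ((Subgroup.center G).relIndex P) (2 ^ k) :=
      (Nat.coprime_two_right.mpr
        (hG.of_dvd_nat (Subgroup.relIndex_dvd_index_of_normal _ _))).pow_right k
    exact Subgroup.relIndex_eq_one.mp
      (hcoprime.eq_one_of_dvd (hk ▸ Subgroup.relIndex_dvd_card _ _))
  have hP : (P : Subgroup G).Normal := ⟨fun x hx g ↦ by
    rwa [Subgroup.mem_center_iff.mp (hP_le hx) g, mul_inv_cancel_right]⟩
  have := Sylow.unique_of_normal P hP
  rw [numSylowTwo, Nat.card_unique]

theorem powDisc_eq [Finite G] (hG : Odd (Subgroup.center G).index) :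
    powDisc G = (-1) ^ ((Nat.card G - (powKernel G 2).ncard) / 2) *
      (Nat.card G : ℤ) ^ (powKernel G 2).ncard := by
  rw [powDisc, numSylowTwo_eq_one hG, one_pow, Nat.div_one, Nat.cast_pow]

theorem ncard_powKernel_ne_zero [Finite G] (m : ℕ) : (powKernel G m).ncard ≠ 0 :=
  Set.ncard_ne_zero_of_mem (a := 1) (one_pow m)

theorem ncard_powKernel_of_coprime {m : ℕ} (hm : (Nat.card G).Coprime m) :
    (powKernel G m).ncard = 1 := by
  rw [Set.ncard_eq_one]
  refine ⟨1, Set.eq_singleton_iff_unique_mem.mpr ⟨one_pow m, fun g hg ↦ ?_⟩⟩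
  exact (powCoprime hm).injective (hg.trans (one_pow m).symm)

theorem natCard_dvd_powDisc [Finite G] (hG : Odd (Subgroup.center G).index) :
    (Nat.card G : ℤ) ∣ powDisc G := by
  rw [powDisc_eq hG]
  exact dvd_mul_of_dvd_right (dvd_pow_self _ (ncard_powKernel_ne_zero 2)) _

theorem powDisc_ne_zero [Finite G] (hG : Odd (Subgroup.center G).index) : powDisc G ≠ 0 := by
  rw [powDisc_eq hG]
  exact mul_ne_zero (pow_ne_zero _ (by norm_num))
    (pow_ne_zero _ (Nat.cast_ne_zero.mpr Nat.card_pos.ne'))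

theorem isCoprime_powDisc [Finite G] (hG : Odd (Subgroup.center G).index) {a : ℤ}
    (ha : IsCoprime a (Nat.card G)) : IsCoprime a (powDisc G) := by
  rw [powDisc_eq hG]
  exact (isCoprime_one_right.neg_right.pow_right).mul_right ha.pow_right

theorem powDisc_emod_four [Finite G] (hG : Odd (Subgroup.center G).index) :
    powDisc G % 4 = 0 ∨ powDisc G % 4 = 1 := by
  obtain ⟨k, hk⟩ := exists_card_eq_powKernel_two G
  rw [powDisc_eq hG]
  rcases (Nat.card G).even_or_odd with heven | hodd
  · refine .inl (Int.emod_eq_zero_of_dvd (dvd_mul_of_dvd_right ?_ _))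
    have hker : 2 ∣ (powKernel G 2).ncard := by
      rw [hk, Nat.even_add] at heven
      exact (heven.mpr (even_two_mul k)).two_dvd
    have htwo : (2 : ℤ) ∣ Nat.card G := by exact_mod_cast heven.two_dvd
    calc (4 : ℤ) = 2 ^ 2 := by norm_num
      _ ∣ (Nat.card G : ℤ) ^ 2 := pow_dvd_pow_of_dvd htwo 2
      _ ∣ _ := pow_dvd_pow _ (Nat.le_of_dvd (ncard_powKernel_ne_zero 2).bot_lt hker)
  · have hker := ncard_powKernel_of_coprime (Nat.coprime_two_right.mpr hodd)
    have hcard : Nat.card G = 2 * k + 1 := by omega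
    right
    rw [hker, hcard, Nat.add_sub_cancel, Nat.mul_div_cancel_left k two_pos, pow_one]
    exact_mod_cast neg_one_pow_mul_emod_four k

theorem sign_inv_eq [Fintype G] [DecidableEq G] :
    Equiv.Perm.sign (Equiv.inv G) = (-1) ^ ((Nat.card G - (powKernel G 2).ncard) / 2) := by
  have hfix : Function.fixedPoints (Equiv.inv G) = powKernel G 2 := by
    ext g
    simp [powKernel, Function.IsFixedPt, pow_two, inv_eq_iff_mul_eq_one]
  rw [Equiv.Perm.sign_of_pow_two_eq_one (by ext g; simp [pow_two]), ← Nat.card_eq_fintype_card,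
    ← Nat.card_eq_fintype_card, Nat.card_coe_set_eq, hfix]

theorem conjClassesInv_mk (g : G) : conjClassesInv G (.mk g) = .mk g⁻¹ := rfl

theorem conjClassesInv_involutive : Function.Involutive (conjClassesInv G) := by
  refine ConjClasses.mk_surjective.forall.mpr fun g ↦ ?_
  rw [conjClassesInv_mk, conjClassesInv_mk, inv_inv]

theorem classCentralizerCard_conjClassesInv (C : ConjClasses G) :
    classCentralizerCard (conjClassesInv G C) = classCentralizerCard C := by
  obtain ⟨g, rfl⟩ := ConjClasses.mk_surjective C
  exact classCentralizerCard_mk_inv g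

theorem setOf_conjClassesInv_eq_self (hG : Odd (Subgroup.center G).index) :
    {C | conjClassesInv G C = C} = ConjClasses.mk '' powKernel G 2 := by
  ext C
  constructor
  · obtain ⟨g, rfl⟩ := ConjClasses.mk_surjective C
    intro hg
    exact ⟨g, sq_eq_one_of_isConj_inv hG (ConjClasses.mk_eq_mk_iff_isConj.mp hg.symm), rfl⟩
  · rintro ⟨g, hg, rfl⟩
    exact congrArg ConjClasses.mk (inv_eq_of_mul_eq_one_left (sq g ▸ hg))

theorem ncard_setOf_conjClassesInv_eq_self (hG : Odd (Subgroup.center G).index) :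
    {C | conjClassesInv G C = C}.ncard = (powKernel G 2).ncard := by
  rw [setOf_conjClassesInv_eq_self hG]
  exact ((ConjClasses.mk_bijOn G).injOn.mono (powKernel_two_subset_center hG)).ncard_image

theorem classCentralizerCard_of_conjClassesInv_eq_self (hG : Odd (Subgroup.center G).index)
    {C : ConjClasses G} (hC : conjClassesInv G C = C) : classCentralizerCard C = Nat.card G := by
  obtain ⟨g, hg, rfl⟩ := (setOf_conjClassesInv_eq_self hG).le hC
  have hcentralizer : Subgroup.centralizer {g} = ⊤ :=
    Subgroup.centralizer_eq_top_iff_subset.mpr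
      (Set.singleton_subset_iff.mpr (powKernel_two_subset_center hG hg))
  rw [classCentralizerCard_mk, hcentralizer, Subgroup.card_top]

theorem legendreSym_prod_classCentralizerCard [Fintype (ConjClasses G)]
    (hG : Odd (Subgroup.center G).index) {p : ℕ} [Fact p.Prime] (hp : ¬ p ∣ Nat.card G) :
    legendreSym p (∏ C : ConjClasses G, (classCentralizerCard C : ℤ)) =
      legendreSym p ((Nat.card G : ℤ) ^ (powKernel G 2).ncard) := by
  classical
  have hcard : (Nat.card G : ZMod p) ≠ 0 := by rwa [Ne, CharP.cast_eq_zero_iff (ZMod p) p]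
  have hcancel (C : ConjClasses G) :
      legendreSym p (classCentralizerCard C) *
        legendreSym p (classCentralizerCard (conjClassesInv G C)) = 1 := by
    rw [classCentralizerCard_conjClassesInv, ← sq]
    refine legendreSym.sq_one p ?_
    rw [Int.cast_natCast]
    exact classCentralizerCard_ne_zero hcard C
  calc legendreSym p (∏ C : ConjClasses G, (classCentralizerCard C : ℤ))
      = ∏ C : ConjClasses G, legendreSym p (classCentralizerCard C) :=
        map_prod (legendreSym.hom p) _ _
    _ = ∏ C with conjClassesInv G C = C, legendreSym p (classCentralizerCard C) :=
        prod_eq_prod_fixed_of_involutive conjClassesInv_involutive fun C _ ↦ hcancel C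
    _ = ∏ C with conjClassesInv G C = C, legendreSym p (Nat.card G) :=
        Finset.prod_congr rfl fun C hC ↦ by
          rw [classCentralizerCard_of_conjClassesInv_eq_self hG (Finset.mem_filter.mp hC).2]
    _ = legendreSym p (Nat.card G) ^ (powKernel G 2).ncard := by
        rw [Finset.prod_const, ← ncard_setOf_conjClassesInv_eq_self hG,
          ← Set.ncard_coe_finset, Finset.coe_filter_univ]
    _ = legendreSym p ((Nat.card G : ℤ) ^ (powKernel G 2).ncard) :=
        (map_pow (legendreSym.hom p) _ _).symm

theorem elemSymbol_congr [Fintype G] [DecidableEq G] {a b : ℤ}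
    (ha : IsCoprime a (Nat.card G : ℤ)) (hb : IsCoprime b (Nat.card G : ℤ))
    (h : a ≡ b [ZMOD Nat.card G]) : elemSymbol G a ha = elemSymbol G b hb := by
  have hperm : powPerm (G := G) a ha = powPerm b hb := Equiv.ext fun g ↦
    zpow_eq_zpow_iff_modEq.mpr (h.of_dvd (Int.natCast_dvd_natCast.mpr (orderOf_dvd_natCard g)))
  rw [elemSymbol, elemSymbol, hperm]

theorem elemSymbol_prime [Fintype G] [DecidableEq G] (hG : Odd (Subgroup.center G).index) {p : ℕ}
    [Fact p.Prime] (hp2 : p ≠ 2) (hp : IsCoprime (p : ℤ) (Nat.card G : ℤ)) :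
    elemSymbol G p hp = legendreSym p (powDisc G) := by
  classical
  have hdvd : ¬ p ∣ Nat.card G :=
    (Fact.out : p.Prime).coprime_iff_not_dvd.mp (Nat.isCoprime_iff_coprime.mp hp)
  have hconj (c g : G) : powPerm (p : ℤ) hp (c * g * c⁻¹) = c * powPerm (p : ℤ) hp g * c⁻¹ :=
    conj_zpow
  have hclasses := legendreSym_sign_mul_prod_classCentralizerCard hp2 hdvd
    (τ := conjClassesPerm _ hconj) fun g ↦ congrArg ConjClasses.mk (zpow_natCast g p)
  rw [sign_conjClassesPerm hG, conjClassesInv, sign_conjClassesPerm hG, sign_inv_eq,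
    legendreSym.mul, legendreSym_prod_classCentralizerCard hG hdvd, ← legendreSym.mul] at hclasses
  rw [elemSymbol, ← hclasses, powDisc_eq hG]
  push_cast
  rfl

end OddCentralIndex

theorem mainTheorem3_general {G : Type*} [Group G] [Fintype G] [DecidableEq G]
    (hG : Odd (Subgroup.center G).index) (a : ℤ) (ha : IsCoprime a (Nat.card G : ℤ)) :
    elemSymbol G a ha = kroneckerSym (powDisc G) a := by
  obtain ⟨p, hp2, hp, hpa⟩ := Nat.forall_exists_prime_gt_and_zmodEq 2
    (Int.natAbs_ne_zero.mpr (powDisc_ne_zero hG)) 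
    ((isCoprime_powDisc hG ha).of_isCoprime_of_dvd_right (Int.natAbs_dvd.mpr dvd_rfl))
  have := Fact.mk hp
  have hpa_disc : p ≡ a [ZMOD powDisc G] := by simpa [Int.modEq_iff_dvd] using hpa
  have hpa_card : p ≡ a [ZMOD Nat.card G] := hpa_disc.of_dvd (natCard_dvd_powDisc hG)
  have hp_card : IsCoprime (p : ℤ) (Nat.card G : ℤ) := isCoprime_of_modEq ha hpa_card.symm
  calc elemSymbol G a ha
      = elemSymbol G p hp_card := elemSymbol_congr ha hp_card hpa_card.symm
    _ = legendreSym p (powDisc G) := elemSymbol_prime hG hp2.ne' hp_card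
    _ = kroneckerSym (powDisc G) p := by
        rw [jacobiSym.legendreSym.to_jacobiSym,
          kroneckerSym_natCast_of_odd _ (hp.odd_of_ne_two hp2.ne')]
    _ = kroneckerSym (powDisc G) a := kroneckerSym_congr (powDisc_emod_four hG) hpa_disc

theorem mainTheorem3 {G : Type*} [Group G] [Fintype G] [DecidableEq G]
    (hG : (∀ x y : G, x * y = y * x) ∨ Odd (Nat.card G))
    (a : ℤ) (ha : IsCoprime a (Nat.card G : ℤ)) :
    elemSymbol G a ha = kroneckerSym (powDisc G) a :=
  mainTheorem3_general (odd_index_center hG) a ha
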